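/- Let $p>1$ be an integer. Let $\mathfrak g'$ be the complex Lie algebra with basis $\{L_m\mid m\in\mathbb Z\}$ and brackets $$[L_m,L_n]=(n-m)L_{m+n},\qquad [L_m,L_r]=rL_{m+r},\qquad [L_r,L_s]=0\qquad (m,n\in p\mathbb Z,\ r,s\notin p\mathbb Z).$$ Let $\mathfrak g$ be its central extension spanned by the $L_m$ ($m\in\mathbb Z$) and central elements $C_i$ ($i\in\mathbb Z/p\mathbb Z$), where the $C_i$ are subject only to the linear relations $C_i=C_{-i}$, with brackets $$[L_m,L_n]=(n-m)L_{m+n}+\delta_{m+n,0}\tfrac1{12}\Big(\big(\tfrac mp\big)^3-\tfrac mp\Big)C_0,\qquad [L_m,L_r]=rL_{m+r},\qquad [L_r,L_s]=\delta_{r+s,0}\,r\,C_{\bar r}$$ for $m,n\in p\mathbb Z$ and $r,s\notin p\mathbb Z$, where $\bar r$ is the residue of $r$ modulo $p$. Put $\mathfrak g_0=\mathrm{span}\{L_0,C_i\mid i\in\mathbb Z/p\mathbb Z\}$. A $\mathfrak g$-module $V$ is a *weight module* if $V=\bigoplus_{\lambda\in\mathfrak g_0^*}V_\lambda$, where $V_\lambda=\{v\in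 V\mid av=\lambda(a)v\text{ for all }a\in\mathfrak g_0\}$. A weight module is *cuspidal* if there is a positive integer $k$ with $\dim V_\lambda<k$ for all $\lambda$, and a *module of intermediate series* if $\dim V_\lambda\le 1$ for all $\lambda$. Every $\mathfrak g'$-module is regarded as a $\mathfrak g$-module through the projection $\mathfrak g\to\mathfrak g'$ that kills the $C_i$. Let $\mathcal A=\mathrm{span}\{t^m\mid m\in p\mathbb Z\}$ be the unital associative algebra with $t^mt^n=t^{m+n}$. An *$\mathcal A\mathfrak g'$-module* is a complex vector space $V$ that is both a $\mathfrak g'$-module and a (unital) $\mathcal A$-module, such that $$L_mt^nv-t^nL_mv=nt^{m+n}v,\qquad t^nL_rv=L_rt^nv\qquad (m,n\in p\mathbb Z,\ r\notin p\mathbb Z,\ v\in V).$$ It is *irreducible* if $V\neq0$ and the only subspaces of $V$ stable under both $\mathcal A$ and $\mathfrak g'$ are $0$ and $V$. **Theorem.** Every irreducible $\mathcal A\mathfrak g'$-module that is cuspidal is a module of intermediate series over $\mathfrak g$. -/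

import Mathlib

noncomputable section

namespace GapVir

/-! The Lie algebra `g'` with basis `L_m`, `m ∈ ℤ`. -/

/-- Structure constants of `g'`: `[L_a, L_b] = c(a, b) L_{a+b}`, where
`[L_m, L_n] = (n - m) L_{m+n}`, `[L_m, L_r] = r L_{m+r}`, `[L_r, L_s] = 0`
for `m, n ∈ pℤ` and `r, s ∉ pℤ`. -/
def structConst (p : ℕ) (a b : ℤ) : ℤ :=
  if (p : ℤ) ∣ a then
    if (p : ℤ) ∣ b then b - a else b
  else
    if (p : ℤ) ∣ b then -a else 0

/-- The underlying vector space of `g'`, with basis indexed by `ℤ`. -/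
def GPrime (_p : ℕ) : Type := ℤ →₀ ℂ

instance (p : ℕ) : AddCommGroup (GPrime p) := inferInstanceAs (AddCommGroup (ℤ →₀ ℂ))

instance (p : ℕ) : Module ℂ (GPrime p) := inferInstanceAs (Module ℂ (ℤ →₀ ℂ))

/-- The basis vector `L_a` of `g'`. -/
def L (p : ℕ) (a : ℤ) : GPrime p := Finsupp.single a (1 : ℂ)

/-- The linear map out of `g'` with prescribed values on the basis `L_a`. -/
def GPrime.lift (p : ℕ) {M : Type*} [AddCommGroup M] [Module ℂ M] (f : ℤ → M) :
    GPrime p →ₗ[ℂ] M :=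
  Finsupp.linearCombination ℂ f

theorem GPrime.lift_L (p : ℕ) {M : Type*} [AddCommGroup M] [Module ℂ M] (f : ℤ → M) (a : ℤ) :
    GPrime.lift p f (L p a) = f a := by
  have h := Finsupp.linearCombination_single ℂ (v := f) (1 : ℂ) a
  rw [one_smul] at h
  exact h

theorem eq_zero_of_eq_neg {M : Type*} [AddCommGroup M] [Module ℂ M] {x : M} (h : x = -x) :
    x = 0 := by
  have h2 : (2 : ℂ) • x = 0 := by
    rw [two_smul]
    nth_rewrite 1 [h]
    exact neg_add_cancel x
  exact (smul_eq_zero.mp h2).resolve_left two_ne_zero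

theorem GPrime.hom_ext {p : ℕ} {M : Type*} [AddCommGroup M] [Module ℂ M]
    {f g : GPrime p →ₗ[ℂ] M} (h : ∀ a, f (L p a) = g (L p a)) : f = g := by
  refine Finsupp.lhom_ext (M := ℂ) (R := ℂ) (α := ℤ) (φ := f) (ψ := g) fun a c => ?_
  have e : (Finsupp.single a c : ℤ →₀ ℂ) = (c • L p a : GPrime p) := by
    refine Eq.trans ?_ (Finsupp.smul_single c a (1 : ℂ)).symm
    rw [smul_eq_mul, mul_one]
  have := congrArg (fun v => c • v) (h a)
  simp only [← map_smul] at this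
  rw [e]
  exact this

/-- The bracket of `g'`, as a bilinear map. -/
def bracketPrime (p : ℕ) : GPrime p →ₗ[ℂ] GPrime p →ₗ[ℂ] GPrime p :=
  GPrime.lift p fun a => GPrime.lift p fun b => (structConst p a b : ℂ) • L p (a + b)

theorem bracketPrime_L (p : ℕ) (a b : ℤ) :
    bracketPrime p (L p a) (L p b) = (structConst p a b : ℂ) • L p (a + b) := by
  rw [bracketPrime, GPrime.lift_L, GPrime.lift_L]

theorem structConst_skew (p : ℕ) (a b : ℤ) : structConst p a b = -structConst p b a := by
  unfold structConst
  split_ifs <;> ring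

theorem structConst_jacobi (p : ℕ) (a b d : ℤ) :
    structConst p b d * structConst p a (b + d) =
      structConst p a b * structConst p (a + b) d +
      structConst p a d * structConst p b (a + d) := by
  by_cases ha : (p : ℤ) ∣ a <;> by_cases hb : (p : ℤ) ∣ b <;> by_cases hd : (p : ℤ) ∣ d <;>
    simp [structConst, ha, hb, hd, dvd_add_right, dvd_add_left] <;> ring

theorem bracketPrime_skew (p : ℕ) (x y : GPrime p) :
    bracketPrime p x y = -bracketPrime p y x := by
  have h : bracketPrime p = -(bracketPrime p).flip := by
    refine GPrime.hom_ext fun a => GPrime.hom_ext fun b => ?_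
    simp only [LinearMap.neg_apply, LinearMap.flip_apply, bracketPrime_L]
    rw [structConst_skew p a b, add_comm b a, Int.cast_neg, neg_smul]
  exact LinearMap.congr_fun₂ h x y

theorem bracketPrime_jacobi (p : ℕ) (x y z : GPrime p) :
    bracketPrime p x (bracketPrime p y z) =
      bracketPrime p (bracketPrime p x y) z + bracketPrime p y (bracketPrime p x z) := by
  let B := bracketPrime p
  have key : ∀ a b d, B (L p a) (B (L p b) (L p d)) =
      B (B (L p a) (L p b)) (L p d) + B (L p b) (B (L p a) (L p d)) := by
    intro a b d
    simp only [B, bracketPrime_L, map_smul, LinearMap.smul_apply, smul_smul]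
    rw [show a + (b + d) = a + b + d by ring, show b + (a + d) = a + b + d by ring, ← add_smul]
    congr 1
    exact_mod_cast structConst_jacobi p a b d
  have k1 : ∀ a b (z : GPrime p), B (L p a) (B (L p b) z) =
      B (B (L p a) (L p b)) z + B (L p b) (B (L p a) z) := fun a b z =>
    LinearMap.congr_fun (f := (B (L p a)).comp (B (L p b)))
      (g := B (B (L p a) (L p b)) + (B (L p b)).comp (B (L p a)))
      (GPrime.hom_ext (key a b)) z
  have k2 : ∀ a (y z : GPrime p), B (L p a) (B y z) =
      B (B (L p a) y) z + B y (B (L p a) z) := fun a y z =>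
    LinearMap.congr_fun (f := (B (L p a)).comp (B.flip z))
      (g := (B.flip z).comp (B (L p a)) + B.flip (B (L p a) z))
      (GPrime.hom_ext fun b => k1 a b z) y
  exact LinearMap.congr_fun (f := B.flip (B y z))
      (g := (B.flip z).comp (B.flip y) + (B y).comp (B.flip z))
      (GPrime.hom_ext fun a => k2 a y z) x

instance (p : ℕ) : LieRing (GPrime p) where
  bracket x y := bracketPrime p x y
  add_lie x y z := by
    change bracketPrime p (x + y) z = bracketPrime p x z + bracketPrime p y z
    rw [map_add, LinearMap.add_apply]
  lie_add x y z := map_add (bracketPrime p x) y z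
  lie_self x := eq_zero_of_eq_neg (bracketPrime_skew p x x)
  leibniz_lie x y z := bracketPrime_jacobi p x y z

instance (p : ℕ) : LieAlgebra ℂ (GPrime p) where
  __ := (inferInstance : Module ℂ (GPrime p))
  lie_smul c x y := map_smul (bracketPrime p x) c y

/-! The Lie algebra `g`, a central extension of `g'` by the span of the elements `C_i`. -/

/-- The relations `C_i = C_{-i}`, `i ∈ ℤ/p`, among the central elements; they are forced by
`[L_r, L_{-r}] = r C_r` and the antisymmetry of the bracket. -/
def centreRel (p : ℕ) : Submodule ℂ (ZMod p →₀ ℂ) :=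
  Submodule.span ℂ
    (Set.range fun i : ZMod p => Finsupp.single i (1 : ℂ) - Finsupp.single (-i) (1 : ℂ))

/-- The vector space spanned by the central elements `C_i`, `i ∈ ℤ/p`, with `C_i = C_{-i}`. -/
abbrev Centre (p : ℕ) : Type := (ZMod p →₀ ℂ) ⧸ centreRel p

/-- The element `C_i` of the centre. -/
def centreGen (p : ℕ) (i : ZMod p) : Centre p :=
  (centreRel p).mkQ (Finsupp.single i (1 : ℂ))

theorem centreGen_neg (p : ℕ) (i : ZMod p) : centreGen p (-i) = centreGen p i := by
  refine ((Submodule.Quotient.eq (centreRel p)).mpr ?_).symm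
  exact Submodule.subset_span ⟨i, rfl⟩

/-- The central term of `[L_a, L_b]`: it vanishes unless `a + b = 0`, and then it is
`(1/12)((a/p)^3 - a/p) C_0` if `a ∈ pℤ`, and `a C_a` if `a ∉ pℤ`. -/
def centralTerm (p : ℕ) (a b : ℤ) : Centre p :=
  if a + b = 0 then
    if (p : ℤ) ∣ a then
      ((1 / 12 : ℂ) * (((a : ℂ) / (p : ℂ)) ^ 3 - (a : ℂ) / (p : ℂ))) • centreGen p 0
    else (a : ℂ) • centreGen p (a : ZMod p)
  else 0

/-- The bilinear extension of the central terms. -/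
def cocycle (p : ℕ) : GPrime p →ₗ[ℂ] GPrime p →ₗ[ℂ] Centre p :=
  GPrime.lift p fun a => GPrime.lift p fun b => centralTerm p a b

theorem cocycle_L (p : ℕ) (a b : ℤ) : cocycle p (L p a) (L p b) = centralTerm p a b := by
  rw [cocycle, GPrime.lift_L, GPrime.lift_L]

theorem centralTerm_skew (p : ℕ) (a b : ℤ) : centralTerm p a b = -centralTerm p b a := by
  unfold centralTerm
  by_cases h : a + b = 0
  · obtain rfl : b = -a := by omega
    by_cases ha : (p : ℤ) ∣ a
    · simp only [add_neg_cancel, neg_add_cancel, ha, dvd_neg, if_true, ← neg_smul]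
      congr 1
      push_cast
      ring
    · simp only [add_neg_cancel, neg_add_cancel, ha, dvd_neg, if_true, if_false, ← neg_smul]
      push_cast
      rw [centreGen_neg, neg_neg]
  · rw [if_neg h, if_neg (by omega), neg_zero]

theorem centralTerm_jacobi (p : ℕ) (a b d : ℤ) :
    (structConst p b d : ℂ) • centralTerm p a (b + d) =
      (structConst p a b : ℂ) • centralTerm p (a + b) d +
      (structConst p a d : ℂ) • centralTerm p b (a + d) := by
  unfold centralTerm
  by_cases h : a + b + d = 0
  · rw [if_pos (show a + (b + d) = 0 by omega), if_pos (show a + b + d = 0 by omega),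
      if_pos (show b + (a + d) = 0 by omega)]
    obtain rfl : d = -a - b := by omega
    have key : (p : ℤ) ∣ -a - b ↔ (p : ℤ) ∣ a + b := by
      rw [show -a - b = -(a + b) by ring, dvd_neg]
    by_cases ha : (p : ℤ) ∣ a
    · have ha' : (a : ZMod p) = 0 := (ZMod.intCast_zmod_eq_zero_iff_dvd a p).mpr ha
      by_cases hb : (p : ℤ) ∣ b
      · simp only [structConst, key, ha, hb, dvd_add_right, if_true, smul_smul, ← add_smul]
        congr 1
        push_cast
        ring
      · simp only [structConst, key, ha, hb, dvd_add_right, if_true, if_false, smul_smul]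
        push_cast
        rw [ha', zero_add, ← add_smul, zero_mul, zero_smul]
        rw [← zero_smul ℂ (centreGen p (b : ZMod p))]
        congr 1
        ring
    · by_cases hb : (p : ℤ) ∣ b
      · have hb' : (b : ZMod p) = 0 := (ZMod.intCast_zmod_eq_zero_iff_dvd b p).mpr hb
        simp only [structConst, key, ha, hb, dvd_add_left, if_true, if_false, smul_smul]
        push_cast
        rw [hb', add_zero, zero_mul, zero_smul, add_zero]
        congr 1
        ring
      · by_cases hab : (p : ℤ) ∣ a + b
        · have hab' : (b : ZMod p) = -(a : ZMod p) := by
            have := (ZMod.intCast_zmod_eq_zero_iff_dvd (a + b) p).mpr hab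
            push_cast at this
            linear_combination this
          simp only [structConst, key, ha, hb, hab, if_true, if_false, smul_smul]
          push_cast
          rw [hab', centreGen_neg, zero_mul, zero_smul, zero_add]
          congr 1
          ring
        · simp only [structConst, key, ha, hb, hab, if_false]
          simp
  · rw [if_neg (show ¬ a + (b + d) = 0 by omega), if_neg (show ¬ a + b + d = 0 by omega),
      if_neg (show ¬ b + (a + d) = 0 by omega)]
    simp

theorem cocycle_skew (p : ℕ) (x y : GPrime p) : cocycle p x y = -cocycle p y x := by
  have h : cocycle p = -(cocycle p).flip := by
    refine GPrime.hom_ext fun a => GPrime.hom_ext fun b => ?_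
    simp only [LinearMap.neg_apply, LinearMap.flip_apply, cocycle_L]
    exact centralTerm_skew p a b
  exact LinearMap.congr_fun₂ h x y

theorem cocycle_jacobi (p : ℕ) (x y z : GPrime p) :
    cocycle p x (bracketPrime p y z) =
      cocycle p (bracketPrime p x y) z + cocycle p y (bracketPrime p x z) := by
  let B := bracketPrime p
  let W := cocycle p
  have key : ∀ a b d, W (L p a) (B (L p b) (L p d)) =
      W (B (L p a) (L p b)) (L p d) + W (L p b) (B (L p a) (L p d)) := by
    intro a b d
    simp only [B, W, bracketPrime_L, map_smul, LinearMap.smul_apply, cocycle_L]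
    exact centralTerm_jacobi p a b d
  have k1 : ∀ a b (z : GPrime p), W (L p a) (B (L p b) z) =
      W (B (L p a) (L p b)) z + W (L p b) (B (L p a) z) := fun a b z =>
    LinearMap.congr_fun (f := (W (L p a)).comp (B (L p b)))
      (g := W (B (L p a) (L p b)) + (W (L p b)).comp (B (L p a)))
      (GPrime.hom_ext (key a b)) z
  have k2 : ∀ a (y z : GPrime p), W (L p a) (B y z) =
      W (B (L p a) y) z + W y (B (L p a) z) := fun a y z =>
    LinearMap.congr_fun (f := (W (L p a)).comp (B.flip z))
      (g := (W.flip z).comp (B (L p a)) + W.flip (B (L p a) z))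
      (GPrime.hom_ext fun b => k1 a b z) y
  exact LinearMap.congr_fun (f := W.flip (B y z))
      (g := (W.flip z).comp (B.flip y) + (W y).comp (B.flip z))
      (GPrime.hom_ext fun a => k2 a y z) x

/-- The gap-`p` Virasoro algebra `g`: as a vector space, the direct sum of `g'` and the span of
the central elements `C_i`. -/
@[ext]
structure Gap (p : ℕ) : Type where
  /-- the component in the span of the `L_a` -/
  fst : GPrime p
  /-- the central component -/
  snd : Centre p

/-- The identification of `g` with `g' × Centre`, used to transport the vector space structure. -/
def Gap.equivProd (p : ℕ) : Gap p ≃ GPrime p × Centre p where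
  toFun x := (x.fst, x.snd)
  invFun x := ⟨x.1, x.2⟩
  left_inv _ := rfl
  right_inv _ := rfl

instance (p : ℕ) : AddCommGroup (Gap p) := (Gap.equivProd p).addCommGroup

instance (p : ℕ) : Module ℂ (Gap p) := (Gap.equivProd p).module ℂ

instance (p : ℕ) : LieRing (Gap p) where
  bracket x y := ⟨⁅x.fst, y.fst⁆, cocycle p x.fst y.fst⟩
  add_lie x y z := Gap.ext (add_lie x.fst y.fst z.fst)
    (LinearMap.map_add₂ (cocycle p) x.fst y.fst z.fst)
  lie_add x y z := Gap.ext (lie_add x.fst y.fst z.fst) (map_add (cocycle p x.fst) y.fst z.fst)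
  lie_self x := Gap.ext (lie_self x.fst) (eq_zero_of_eq_neg (cocycle_skew p x.fst x.fst))
  leibniz_lie x y z := Gap.ext (leibniz_lie x.fst y.fst z.fst)
    (cocycle_jacobi p x.fst y.fst z.fst)

instance (p : ℕ) : LieAlgebra ℂ (Gap p) where
  __ := (inferInstance : Module ℂ (Gap p))
  lie_smul c x y := Gap.ext (lie_smul c x.fst y.fst) (map_smul (cocycle p x.fst) c y.fst)

/-- The basis element `L_a` of `g`. -/
def Gap.L (p : ℕ) (a : ℤ) : Gap p := ⟨GapVir.L p a, 0⟩

/-- The central element `C_i` of `g`. -/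
def Gap.C (p : ℕ) (i : ZMod p) : Gap p := ⟨0, centreGen p i⟩

/-- The Cartan subalgebra `g_0` of `g`, spanned by `L_0` and the `C_i`. -/
def Gap.cartan (p : ℕ) : Submodule ℂ (Gap p) :=
  Submodule.span ℂ (insert (Gap.L p 0) (Set.range (Gap.C p)))

/-- The canonical surjection `g → g'`, which sends `L_a` to `L_a` and kills the `C_i`. -/
def Gap.proj (p : ℕ) : Gap p →ₗ⁅ℂ⁆ GPrime p where
  toFun x := x.fst
  map_add' _ _ := rfl
  map_smul' _ _ := rfl
  map_lie' := rfl

/-! Weight modules over `g`. -/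

section Weights

variable (p : ℕ) (V : Type*) [AddCommGroup V] [Module ℂ V]
  [LieRingModule (Gap p) V] [LieModule ℂ (Gap p) V]

/-- The weight space `V_lam = {v | a v = lam(a) v for all a ∈ g_0}` for `lam ∈ g_0^*`. -/
def weightSpace (lam : Module.Dual ℂ (Gap.cartan p)) : Submodule ℂ V where
  carrier := {v | ∀ a : Gap.cartan p, ⁅(a : Gap p), v⁆ = lam a • v}
  add_mem' {v w} hv hw a := by rw [lie_add, hv a, hw a, smul_add]
  zero_mem' a := by rw [lie_zero, smul_zero]
  smul_mem' c v hv a := by rw [lie_smul, hv a, smul_comm]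

/-- `V` is a weight module: `g_0` acts diagonalizably, that is, `V` is the sum of its weight spaces
(the sum of simultaneous eigenspaces is automatically direct). -/
def IsWeightModule : Prop :=
  ⨆ lam : Module.Dual ℂ (Gap.cartan p), weightSpace p V lam = ⊤

/-- `V` is cuspidal: a weight module with uniformly bounded weight multiplicities. -/
def IsCuspidal : Prop :=
  IsWeightModule p V ∧ ∃ k : ℕ, 0 < k ∧
    ∀ lam : Module.Dual ℂ (Gap.cartan p), Module.rank ℂ (weightSpace p V lam) < (k : Cardinal)

/-- `V` is a module of intermediate series: a weight module all of whose weight spaces have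
dimension at most one. -/
def IsMOIS : Prop :=
  IsWeightModule p V ∧
    ∀ lam : Module.Dual ℂ (Gap.cartan p), Module.rank ℂ (weightSpace p V lam) ≤ 1

end Weights

/-! Modules over `g'` with a compatible action of `A`. -/

/-- The unital associative algebra `A` with basis `t^m`, `m ∈ pℤ`, and `t^m t^n = t^{m+n}`:
the group algebra of `pℤ`. -/
abbrev A (p : ℕ) : Type := AddMonoidAlgebra ℂ (AddSubgroup.zmultiples (p : ℤ))

/-- The basis element `t^n` of `A`. -/
def t (p : ℕ) (n : AddSubgroup.zmultiples (p : ℤ)) : A p := AddMonoidAlgebra.single n 1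

section Modules

variable (p : ℕ) (V : Type*) [AddCommGroup V] [Module ℂ V]
  [LieRingModule (GPrime p) V] [LieModule ℂ (GPrime p) V]

/-- Along `g → g'`, a `g'`-module is regarded as a `g`-module. -/
instance inflation : LieRingModule (Gap p) V := LieRingModule.compLieHom V (Gap.proj p)

instance inflation_lieModule : LieModule ℂ (Gap p) V := LieModule.compLieHom V (Gap.proj p)

variable [Module (A p) V]

/-- Compatibility of a `g'`-action and an (associative, unital) `A`-action on `V`:
`L_m t^n v - t^n L_m v = n t^{m+n} v` and `t^n L_r v = L_r t^n v` for `m, n ∈ pℤ`, `r ∉ pℤ`. -/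
structure IsAGPrimeModule : Prop where
  lie_t_smul : ∀ (m n : AddSubgroup.zmultiples (p : ℤ)) (v : V),
    ⁅L p (m : ℤ), t p n • v⁆ - t p n • ⁅L p (m : ℤ), v⁆ = ((n : ℤ) : ℂ) • (t p (m + n) • v)
  t_smul_lie : ∀ (n : AddSubgroup.zmultiples (p : ℤ)) (r : ℤ), ¬ (p : ℤ) ∣ r → ∀ v : V,
    t p n • ⁅L p r, v⁆ = ⁅L p r, t p n • v⁆

/-- Irreducibility as an `Ag'`-module: `V ≠ 0`, and the only subspaces stable under both `A` and
`g'` are `0` and `V`. -/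
def IsIrreducibleAG : Prop :=
  Nontrivial V ∧ ∀ W : Submodule ℂ V,
    (∀ a : A p, ∀ w ∈ W, a • w ∈ W) → (∀ x : GPrime p, ∀ w ∈ W, ⁅x, w⁆ ∈ W) →
      W = ⊥ ∨ W = ⊤

end Modules

end GapVir

end

/-! Dividing out powers of `t` makes the action `A`-linear: `D m = (t^{-pm} L_{pm} - L_0) / p` and
the `L_r` with `r ∉ pℤ` commute with `A`, while `L_0` only records the grading. By irreducibility
the weights lie in one coset of `ℤ`, and the invertible `t^{pk}` shift them by multiples of `p`, so
`V` is finitely generated over `A` (`module_finite`).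

The `L_r` commute with one another, and `[D m, L_r]` is a multiple of `t^{-pm} L_{r+pm} - L_r`.
Jacobson's lemma over `A` makes these differences nilpotent. Commuting nilpotents on a nonzero
finitely generated module cannot have images that sum to everything, so irreducibility forces them
to vanish (`shiftDiff_eq_zero`), and the `D m` commute with the `L_r`.

The `D m` bracket like the vector fields `(x^m - 1) x d/dx`, which vanish at `1`. Those vanishing
there to second order, the second differences, kill a nonzero vector of a finite-dimensional weight
space, hence all of `V` (`secondDiff_eq_zero`). So `D m = m D 1`, and `D 1` is a scalar by Schur's
lemma (`exists_eq_smul`).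

Now `V` is spanned by monomials in the `t^{pk}` and `L_r` applied to one weight vector. A monomial
of degree zero commutes with everything, so it is a scalar, and each weight space is at most a line
(`exists_smul_eq_of_mem_eigenspace`). -/

noncomputable section

namespace GapVir

/-! ### Nilpotent endomorphisms of finite modules over a commutative ring -/

section Nilpotent

variable {R M : Type*} [CommRing R] [AddCommGroup M] [Module R M]

/-- If `[D, X]` commutes with `X`, then `D` acts on polynomials in `X` as `[D, X] d/dX`. -/
theorem mul_aeval_sub_aeval_mul {D X Y : Module.End R M} (h : D * X - X * D = Y)
    (hY : Commute Y X) (f : Polynomial R) :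
    D * Polynomial.aeval X f - Polynomial.aeval X f * D =
      Polynomial.aeval X (Polynomial.derivative f) * Y := by
  have hX : D * X = X * D + Y := by rw [← h]; abel
  have hpow : ∀ n : ℕ, D * X ^ n - X ^ n * D = (n : R) • (X ^ (n - 1) * Y) := by
    intro n
    induction n with
    | zero => simp
    | succ n ih =>
      have e : D * X ^ (n + 1) - X ^ (n + 1) * D = (D * X ^ n - X ^ n * D) * X + X ^ n * Y := by
        rw [← h]; noncomm_ring
      rw [e, ih, smul_mul_assoc, mul_assoc, hY.eq, ← mul_assoc, Nat.add_sub_cancel]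
      rcases n with _ | n
      · simp
      · rw [Nat.add_sub_cancel, ← pow_succ, Nat.cast_add (n + 1) 1, add_smul, Nat.cast_one,
          one_smul]
  induction f using Polynomial.induction_on' with
  | add f g hf hg =>
    simp only [map_add, add_mul, mul_add]
    rw [← hf, ← hg]
    abel
  | monomial n a =>
    rw [Polynomial.derivative_monomial, Polynomial.aeval_monomial, Polynomial.aeval_monomial,
      Algebra.algebraMap_eq_smul_one, Algebra.algebraMap_eq_smul_one, smul_one_mul, smul_one_mul,
      mul_smul_comm, smul_mul_assoc, ← smul_sub, hpow, smul_smul, smul_mul_assoc]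

/-- Jacobson's lemma over a commutative `ℚ`-algebra: if `[D, X]` commutes with `X`,
then it is nilpotent. -/
theorem isNilpotent_commutator [Algebra ℂ R] [Module.Finite R M] {D X Y : Module.End R M}
    (h : D * X - X * D = Y) (hY : Commute Y X) : IsNilpotent Y := by
  obtain ⟨f, hf, hfX⟩ := LinearMap.exists_monic_and_aeval_eq_zero R X
  have hc : ∀ g : Polynomial R, Commute Y (Polynomial.aeval X g) := fun g => by
    induction g using Polynomial.induction_on' with
    | add f g hf hg => rw [map_add]; exact hf.add_right hg
    | monomial n a =>
      rw [Polynomial.aeval_monomial]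
      exact Commute.mul_right (Algebra.commutes a Y).symm (hY.pow_right n)
  have key : ∀ j : ℕ, ∃ k : ℕ,
      Polynomial.aeval X (Polynomial.derivative^[j] f) * Y ^ k = 0 := by
    intro j
    induction j with
    | zero => exact ⟨0, by simp [hfX]⟩
    | succ j ih =>
      obtain ⟨k, hk⟩ := ih
      refine ⟨k + 1 + k, ?_⟩
      rw [Function.iterate_succ_apply']
      set g := Polynomial.derivative^[j] f
      have e := mul_aeval_sub_aeval_mul h hY g
      have hk' : Y ^ k * Polynomial.aeval X g = 0 := by rw [((hc g).pow_left k).eq, hk]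
      have hcg : Y ^ k * Polynomial.aeval X (Polynomial.derivative g) =
        Polynomial.aeval X (Polynomial.derivative g) * Y ^ k := ((hc _).pow_left k).eq
      -- Sandwich `[D, g(X)] = g'(X) Y` between two factors `Y ^ k`: both terms of the commutator
      -- then contain `g(X) Y ^ k = 0`.
      calc Polynomial.aeval X (Polynomial.derivative g) * Y ^ (k + 1 + k)
          = Y ^ k * (Polynomial.aeval X (Polynomial.derivative g) * Y) * Y ^ k := by
            rw [← mul_assoc, hcg, pow_add, pow_succ]; noncomm_ring
        _ = Y ^ k * D * (Polynomial.aeval X g * Y ^ k)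
            - Y ^ k * Polynomial.aeval X g * D * Y ^ k := by
            rw [← e]; noncomm_ring
        _ = 0 := by rw [hk, hk']; simp
  obtain ⟨k, hk⟩ := key f.natDegree
  refine ⟨k, ?_⟩
  -- Since `f` is monic, differentiating it `n = deg f` times leaves the constant `n!`, a unit
  -- because `R` is a `ℂ`-algebra. Thus `n! Y ^ k = 0` gives `Y ^ k = 0`.
  have hd : Polynomial.derivative^[f.natDegree] f =
      Polynomial.C ((f.natDegree.factorial : ℕ) : R) := by
    have h0 : (Polynomial.derivative^[f.natDegree] f).natDegree = 0 := by
      have := Polynomial.natDegree_iterate_derivative f f.natDegree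
      omega
    rw [Polynomial.eq_C_of_natDegree_eq_zero h0, Polynomial.coeff_iterate_derivative]
    simp [hf.coeff_natDegree, Nat.descFactorial_self]
  rw [hd, Polynomial.aeval_C, Algebra.algebraMap_eq_smul_one, smul_one_mul] at hk
  have hu : ((f.natDegree.factorial : ℕ) : R) =
      algebraMap ℂ R (f.natDegree.factorial : ℂ) := by simp
  have hu' : IsUnit ((f.natDegree.factorial : ℕ) : R) := by
    rw [hu]
    exact (IsUnit.mk0 _ (by exact_mod_cast Nat.factorial_ne_zero _)).map _
  exact (hu'.smul_eq_zero).mp hk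

/-- Finitely many commuting nilpotent endomorphisms whose ranges span the module. -/
theorem subsingleton_of_iSup_range_eq_top {ι : Type*} (E : ι → Module.End R M)
    (hE : ∀ i, IsNilpotent (E i)) (hc : ∀ i j, Commute (E i) (E j)) (s : Finset ι)
    (hs : ⨆ i ∈ s, LinearMap.range (E i) = ⊤) : Subsingleton M := by
  classical
  induction s using Finset.induction_on with
  | empty =>
    simp only [Finset.notMem_empty, iSup_false, iSup_bot] at hs
    exact (Submodule.subsingleton_iff R).mp (subsingleton_of_bot_eq_top hs)
  | insert i s _ ih =>
    apply ih
    rw [Finset.iSup_insert] at hs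
    set Q := ⨆ j ∈ s, LinearMap.range (E j)
    have hQ : Q.map (E i) ≤ Q := by
      simp only [Q, Submodule.map_iSup]
      refine iSup₂_mono fun j _ => ?_
      rintro _ ⟨_, ⟨v, rfl⟩, rfl⟩
      exact ⟨E i v, (LinearMap.congr_fun (hc i j).eq v).symm⟩
    -- Applying `E i` to `range (E i ^ k) + Q = M` and using that `Q` is `E i`-stable raises the
    -- exponent by one. Nilpotency then leaves `Q = M`, which discards `i`.
    have key : ∀ k : ℕ, LinearMap.range (E i ^ k) ⊔ Q = ⊤ := by
      intro k
      induction k with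
      | zero => simp [Module.End.one_eq_id]
      | succ k ihk =>
        refine top_le_iff.mp (hs.symm.le.trans (sup_le ?_ le_sup_right))
        rw [LinearMap.range_eq_map, ← ihk, Submodule.map_sup, pow_succ', Module.End.mul_eq_comp,
          LinearMap.range_comp]
        exact sup_le_sup le_rfl hQ
    obtain ⟨n, hn⟩ := hE i
    have := key n
    rwa [hn, LinearMap.range_zero, bot_sup_eq] at this

end Nilpotent

/-! ### Vector fields vanishing at a point, and their finite-dimensional representations -/

section SecondDifference

variable {R M : Type*} [CommRing R] [AddCommGroup M] [Module R M]

/-- The second difference of a sequence of endomorphisms. -/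
def secondDiff (D : ℤ → Module.End R M) (j : ℤ) : Module.End R M :=
  D (j + 1) - (2 : ℤ) • D j + D (j - 1)

/-- The commutation relations of the operators `t^{-m} L_m - L_0`. -/
def WittRel (D : ℤ → Module.End R M) : Prop :=
  ∀ m n : ℤ, D m * D n - D n * D m = (n - m) • D (m + n) - n • D n + m • D m

/-- In the model `D n = (x^n - 1) x d/dx` the second difference is `x^{j-1} (x - 1)^2 x d/dx`.
Fields with a double zero at `1` form an ideal, and this is its explicit bracket with first
differences. -/
theorem WittRel.secondDiff_comm {D : ℤ → Module.End R M} (h : WittRel D) (j n : ℤ) :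
    secondDiff D j * (D n - D (n - 1)) - (D n - D (n - 1)) * secondDiff D j =
      (n - 1 - j) • secondDiff D (j + n) + (j - n) • secondDiff D (j + n - 1) := by
  have e : secondDiff D j * (D n - D (n - 1)) - (D n - D (n - 1)) * secondDiff D j =
      (D (j + 1) * D n - D n * D (j + 1)) - (D (j + 1) * D (n - 1) - D (n - 1) * D (j + 1))
      - (2 : ℤ) • ((D j * D n - D n * D j) - (D j * D (n - 1) - D (n - 1) * D j))
      + ((D (j - 1) * D n - D n * D (j - 1)) -
        (D (j - 1) * D (n - 1) - D (n - 1) * D (j - 1))) := by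
    unfold secondDiff
    noncomm_ring
  rw [e, h, h, h, h, h, h]
  unfold secondDiff
  rw [show j + 1 + n = j + n + 1 by ring, show j + 1 + (n - 1) = j + n by ring,
    show j + (n - 1) = j + n - 1 by ring, show j - 1 + n = j + n - 1 by ring,
    show j - 1 + (n - 1) = j + n - 1 - 1 by ring, show j + n - 1 + 1 = j + n by ring]
  module

theorem WittRel.secondDiff_apply {D : ℤ → Module.End R M} (h : WittRel D) (j n : ℤ) (v : M) :
    secondDiff D j ((D n - D (n - 1)) v) = (D n - D (n - 1)) (secondDiff D j v) +
      ((n - 1 - j) • secondDiff D (j + n) v + (j - n) • secondDiff D (j + n - 1) v) := by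
  have := LinearMap.congr_fun (h.secondDiff_comm j n) v
  simp only [LinearMap.sub_apply, Module.End.mul_apply, LinearMap.add_apply,
    LinearMap.smul_apply] at this ⊢
  rw [← this]
  abel

/-- A property of vectors stable under all `D n - D (n - 1)` is stable under all `D n`. -/
theorem mem_of_diff_mem {D : ℤ → Module.End R M} (h0 : D 0 = 0) (W : Submodule R M) {v : M}
    (hv : ∀ n, (D n - D (n - 1)) v ∈ W) (n : ℤ) : D n v ∈ W := by
  induction n using Int.induction_on with
  | zero => simp [h0]
  | succ n ih =>
    have := W.add_mem (hv (n + 1)) ih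
    simpa using this
  | pred n ih =>
    have := W.sub_mem ih (hv (-n))
    simpa using this

/-- An eigenvalue of maximal real part works; it plays the role of a highest weight. -/
theorem exists_eigenvalue_add_nat_not {U : Type*} [AddCommGroup U] [Module ℂ U]
    [FiniteDimensional ℂ U] [Nontrivial U] (f : Module.End ℂ U) :
    ∃ c : ℂ, f.HasEigenvalue c ∧ ∀ k : ℕ, 0 < k → ¬ f.HasEigenvalue (c + k) := by
  have hfin : Set.Finite {c | f.HasEigenvalue c} := Module.End.finite_hasEigenvalue f
  obtain ⟨c0, hc0⟩ := Module.End.exists_eigenvalue f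
  obtain ⟨c, hc, hmax⟩ := Set.exists_max_image _ Complex.re hfin ⟨c0, hc0⟩
  refine ⟨c, hc, fun k hk h => ?_⟩
  have := hmax _ h
  simp only [Complex.add_re, Complex.natCast_re] at this
  have : (0 : ℝ) < k := by exact_mod_cast hk
  linarith

/-- In a finite-dimensional representation some nonzero vector is killed by all the second
differences. -/
theorem WittRel.exists_secondDiff_eq_zero {U : Type*} [AddCommGroup U] [Module ℂ U]
    [FiniteDimensional ℂ U] [Nontrivial U] {D : ℤ → Module.End ℂ U} (h : WittRel D) :
    ∃ v : U, v ≠ 0 ∧ ∀ j, secondDiff D j v = 0 := by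
  obtain ⟨c, hc, hmax⟩ := exists_eigenvalue_add_nat_not (D 0 - D (0 - 1))
  obtain ⟨v, hv⟩ := hc.exists_hasEigenvector
  have hstep : ∀ s : ℕ, (s : ℤ) • secondDiff D ((s : ℤ) + 0 - 1) v = 0 →
      secondDiff D s v = 0 := by
    intro s hs
    by_contra hne
    -- The bracket formula at `n = 0` makes a nonzero `secondDiff D s v` an eigenvector of `D 0 - D
    -- (-1)` with eigenvalue `c + s + 1`, which is excluded.
    refine hmax (s + 1) s.succ_pos (Module.End.hasEigenvalue_of_hasEigenvector
      (Module.End.hasEigenvector_iff.mpr ⟨Module.End.mem_eigenspace_iff.mpr ?_, hne⟩))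
    have e := h.secondDiff_apply (s : ℤ) 0 v
    rw [hv.apply_eq_smul, map_smul, sub_zero (s : ℤ), hs, add_zero, add_zero,
      ← sub_eq_iff_eq_add] at e
    rw [← e]
    module
  have hpos : ∀ s : ℕ, secondDiff D s v = 0 := by
    intro s
    induction s with
    -- The coefficient `s` vanishes at `s = 0`, so nothing is needed about index `-1`.
    | zero => exact hstep 0 (by simp)
    | succ s ih =>
      refine hstep (s + 1) ?_
      rw [show ((s + 1 : ℕ) : ℤ) + 0 - 1 = s by push_cast; ring, ih, smul_zero]
  -- The common kernels of the second differences of index at least `s` grow with `s`, hence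
  -- stabilize; the stable one will be invariant under all first differences.
  let K : ℕ →o Submodule ℂ U :=
    ⟨fun s => ⨅ j : {j : ℤ // (s : ℤ) ≤ j}, LinearMap.ker (secondDiff D j), fun s s' hs =>
      le_iInf fun j => iInf_le_of_le ⟨j, le_trans (by exact_mod_cast hs) j.2⟩ le_rfl⟩
  have hK : ∀ s u, u ∈ K s ↔ ∀ j : ℤ, (s : ℤ) ≤ j → secondDiff D j u = 0 := by
    intro s u
    change u ∈ (⨅ j : {j : ℤ // (s : ℤ) ≤ j}, LinearMap.ker (secondDiff D j)) ↔ _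
    simp [Submodule.mem_iInf]
  obtain ⟨N, hN⟩ := monotone_stabilizes_iff_noetherian.mpr
    (inferInstance : IsNoetherian ℂ U) K
  have hvK : v ∈ K N := (hK N v).mpr fun j hj => by
    obtain ⟨s, rfl⟩ := Int.eq_ofNat_of_zero_le ((Int.natCast_nonneg N).trans hj)
    exact hpos s
  have hstable : ∀ u ∈ K N, ∀ n, (D n - D (n - 1)) u ∈ K N := by
    intro u hu n
    -- The margin `|n| + 1` keeps the indices `j`, `j + n` and `j + n - 1` of the bracket formula at
    -- least `N`.
    rw [hN (N + (n.natAbs + 1)) (by omega)]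
    refine (hK _ _).mpr fun j hj => ?_
    push_cast at hj
    have hn := neg_abs_le n
    have hn0 := abs_nonneg n
    have hu' := (hK N u).mp hu
    rw [h.secondDiff_apply, hu' j (by omega), hu' (j + n) (by omega),
      hu' (j + n - 1) (by omega)]
    simp
  refine ⟨v, hv.2, fun T => ?_⟩
  -- Reach an arbitrary index `T` as `j + (T - j)` with `j` large. Two consecutive `j` give
  -- independent relations between the values at `T` and `T - 1`, so both vanish.
  have hrel : ∀ j : ℤ, (N : ℤ) ≤ j → (T - j - 1 - j) • secondDiff D T v +
      (j - (T - j)) • secondDiff D (T - 1) v = 0 := by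
    intro j hj
    have e := h.secondDiff_apply j (T - j) v
    rw [(hK N _).mp (hstable v hvK (T - j)) j hj, (hK N v).mp hvK j hj, map_zero, zero_add,
      show j + (T - j) = T by ring] at e
    exact e.symm
  have e0 := hrel N le_rfl
  have e1 := hrel (N + 1) (by omega)
  have e3 : (2 : ℤ) • (secondDiff D (T - 1) v - secondDiff D T v) = 0 := by
    linear_combination (norm := module) e1 - e0
  have e4 : secondDiff D (T - 1) v = secondDiff D T v := by
    rw [← sub_eq_zero]
    refine (smul_eq_zero.mp ?_ : (2 : ℂ) = 0 ∨ _).resolve_left two_ne_zero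
    rw [← e3, two_smul, two_smul]
  rw [e4] at e0
  linear_combination (norm := module) -e0

end SecondDifference

/-! ### The module as a graded `A`-module with `A`-linear operators -/

/-- The operators describing an irreducible `Ag'`-module with finite-dimensional weight spaces:
`T k = t^{pk}`, `H = L_0`, `D k = (t^{-pk} L_{pk} - L_0) / p`, and `X r = L_r` for `r ∉ pℤ`
(with `X r = 0` otherwise). -/
structure IrredOperators (p : ℕ) (R V : Type*) [CommRing R] [Algebra ℂ R] [AddCommGroup V]
    [Module ℂ V] [Module R V] [IsScalarTower ℂ R V] where
  T : ℤ → R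
  H : Module.End ℂ V
  D : ℤ → Module.End R V
  X : ℤ → Module.End R V
  p_pos : 0 < p
  T_zero : T 0 = 1
  T_add : ∀ k l, T (k + l) = T k * T l
  span_T : Submodule.span ℂ (Set.range T) = ⊤
  H_T : ∀ k v, H (T k • v) = T k • H v + ((p * k : ℤ) : ℂ) • T k • v
  H_D : ∀ m v, H (D m v) = D m (H v)
  H_X : ∀ r v, H (X r v) = X r (H v) + (r : ℂ) • X r v
  D_zero : D 0 = 0
  D_D : WittRel D
  D_X : ∀ m r, D m * X r - X r * D m =
    algebraMap ℂ R ((r : ℂ) / p) • (T (-m) • X (r + p * m) - X r)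
  X_X : ∀ r s, Commute (X r) (X s)
  -- Zero is consistent with `D_X`, as `r` and `r + p * m` lie in `pℤ` together; all relations then
  -- hold without case distinctions.
  X_mul : ∀ m : ℤ, X (p * m) = 0
  nontrivial : Nontrivial V
  irr : ∀ W : Submodule ℂ V, (∀ k, ∀ w ∈ W, T k • w ∈ W) → (∀ w ∈ W, H w ∈ W) →
    (∀ m, ∀ w ∈ W, D m w ∈ W) → (∀ r, ∀ w ∈ W, X r w ∈ W) → W = ⊥ ∨ W = ⊤
  iSup_eigenspace : ⨆ c, H.eigenspace c = ⊤
  finite_eigenspace : ∀ c, FiniteDimensional ℂ (H.eigenspace c)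

namespace IrredOperators

variable {p : ℕ} {R V : Type*} [CommRing R] [Algebra ℂ R] [AddCommGroup V]
    [Module ℂ V] [Module R V] [IsScalarTower ℂ R V] (S : IrredOperators p R V)

include S

/-- `H` is not `R`-linear, but it acts on `R` as a derivation. This is what keeps the `R`-span of a
set stable under `H` once `H` maps the set into that span. -/
theorem exists_H_smul (a : R) : ∃ b : R, ∀ v, S.H (a • v) = a • S.H v + b • v := by
  have ha : a ∈ Submodule.span ℂ (Set.range S.T) := by rw [S.span_T]; trivial
  induction ha using Submodule.span_induction with
  | mem x hx =>
    obtain ⟨k, rfl⟩ := hx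
    exact ⟨((p * k : ℤ) : ℂ) • S.T k, fun v => by rw [S.H_T, smul_assoc]⟩
  | zero => exact ⟨0, by simp⟩
  | add x y _ _ hx hy =>
    obtain ⟨b, hb⟩ := hx
    obtain ⟨c, hc⟩ := hy
    exact ⟨b + c, fun v => by rw [add_smul, map_add, hb, hc]; module⟩
  | smul c x _ hx =>
    obtain ⟨b, hb⟩ := hx
    exact ⟨c • b, fun v => by
      rw [smul_assoc, map_smul, hb, smul_add, smul_assoc, smul_assoc]⟩

theorem eq_bot_or_eq_top (W : Submodule R V) (hH : ∀ w ∈ W, S.H w ∈ W)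
    (hD : ∀ m, ∀ w ∈ W, S.D m w ∈ W) (hX : ∀ r, ∀ w ∈ W, S.X r w ∈ W) : W = ⊥ ∨ W = ⊤ := by
  have := S.irr (W.restrictScalars ℂ) (fun k w hw => W.smul_mem _ hw) hH hD hX
  simpa using this

theorem span_eq_top (s : Set V) (hs : ∃ v ∈ s, v ≠ 0)
    (hH : ∀ w ∈ s, S.H w ∈ Submodule.span R s)
    (hD : ∀ m, ∀ w ∈ s, S.D m w ∈ Submodule.span R s)
    (hX : ∀ r, ∀ w ∈ s, S.X r w ∈ Submodule.span R s) : Submodule.span R s = ⊤ := by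
  refine (S.eq_bot_or_eq_top _ ?_ ?_ ?_).resolve_left ?_
  · intro w hw
    induction hw using Submodule.span_induction with
    | mem x hx => exact hH x hx
    | zero => simp
    | add x y _ _ hx hy => rw [map_add]; exact Submodule.add_mem _ hx hy
    | smul a x hx hx' =>
      obtain ⟨b, hb⟩ := S.exists_H_smul a
      rw [hb]
      exact Submodule.add_mem _ (Submodule.smul_mem _ _ hx') (Submodule.smul_mem _ _ hx)
  · exact fun m w hw => (Submodule.span_le (p := (Submodule.span R s).comap (S.D m))).mpr (hD m) hw
  · exact fun r w hw => (Submodule.span_le (p := (Submodule.span R s).comap (S.X r))).mpr (hX r) hw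
  · obtain ⟨v, hv, hv0⟩ := hs
    exact fun h => hv0 ((Submodule.mem_bot R).mp (h ▸ Submodule.subset_span hv))

theorem exists_eigenspace_ne_bot : ∃ c, S.H.eigenspace c ≠ ⊥ := by
  by_contra! h
  have := S.iSup_eigenspace
  have := S.nontrivial
  simp_all

theorem D_mem {c : ℂ} {v : V} (hv : v ∈ S.H.eigenspace c) (m : ℤ) :
    S.D m v ∈ S.H.eigenspace c := by
  rw [Module.End.mem_eigenspace_iff] at hv ⊢
  rw [S.H_D, hv, LinearMap.map_smul_of_tower]

theorem X_mem {c : ℂ} {v : V} (hv : v ∈ S.H.eigenspace c) (r : ℤ) :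
    S.X r v ∈ S.H.eigenspace (c + r) := by
  rw [Module.End.mem_eigenspace_iff] at hv ⊢
  rw [S.H_X, hv, LinearMap.map_smul_of_tower, add_smul]

theorem T_mem {c : ℂ} {v : V} (hv : v ∈ S.H.eigenspace c) (k : ℤ) :
    S.T k • v ∈ S.H.eigenspace (c + (p * k : ℤ)) := by
  rw [Module.End.mem_eigenspace_iff] at hv ⊢
  rw [S.H_T, hv, smul_comm, add_smul]

theorem T_smul_T_neg_smul (k : ℤ) (v : V) : S.T k • S.T (-k) • v = v := by
  rw [smul_smul, ← S.T_add, add_neg_cancel, S.T_zero, one_smul]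

/-- The weight spaces in one coset `c + ℤ` generate a submodule, hence `V`. Multiplication by the
units `T k` reduces them to the `p` finite-dimensional ones of weight `c + j`, `0 ≤ j < p`. -/
theorem module_finite : Module.Finite R V := by
  obtain ⟨c, hc⟩ := S.exists_eigenspace_ne_bot
  obtain ⟨v, hv, hv0⟩ := Submodule.exists_mem_ne_zero_of_ne_bot hc
  have htop : Submodule.span R (⋃ j : ℤ, (S.H.eigenspace (c + j) : Set V)) = ⊤ := by
    apply S.span_eq_top
    · exact ⟨v, Set.mem_iUnion.mpr ⟨0, by simpa using hv⟩, hv0⟩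
    all_goals
      simp only [Set.mem_iUnion, SetLike.mem_coe]
    · rintro w ⟨j, hw⟩
      refine Submodule.subset_span (Set.mem_iUnion.mpr ⟨j, ?_⟩)
      rw [SetLike.mem_coe, Module.End.mem_eigenspace_iff.mp hw]
      exact Submodule.smul_mem _ _ hw
    · rintro m w ⟨j, hw⟩
      exact Submodule.subset_span (Set.mem_iUnion.mpr ⟨j, S.D_mem hw m⟩)
    · rintro r w ⟨j, hw⟩
      refine Submodule.subset_span (Set.mem_iUnion.mpr ⟨j + r, ?_⟩)
      have := S.X_mem hw r
      rwa [add_assoc, ← Int.cast_add] at this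
  have hfg : ∀ d : ℂ, (Submodule.span R (S.H.eigenspace d : Set V)).FG := by
    intro d
    have := S.finite_eigenspace d
    obtain ⟨s, hs⟩ := (Module.Finite.iff_fg.mp this : (S.H.eigenspace d).FG)
    exact ⟨s, by rw [← hs, Submodule.span_span_of_tower]⟩
  have hsup : (⨆ j ∈ Finset.range p, Submodule.span R (S.H.eigenspace (c + (j : ℂ)) : Set V)).FG :=
    Submodule.fg_biSup _ _ fun j _ => hfg _
  refine ⟨?_⟩
  rw [← htop]
  convert hsup
  refine le_antisymm (Submodule.span_le.mpr (Set.iUnion_subset fun j w hw => ?_)) (iSup₂_le ?_)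
  · have hp : (p : ℤ) ≠ 0 := by exact_mod_cast S.p_pos.ne'
    have h1 := Int.emod_nonneg j hp
    have h2 := Int.emod_lt_of_pos j (by exact_mod_cast S.p_pos : (0 : ℤ) < p)
    have h3 := Int.emod_add_mul_ediv j p
    obtain ⟨i, hi⟩ := Int.eq_ofNat_of_zero_le h1
    rw [← S.T_smul_T_neg_smul (j / p) w]
    refine Submodule.smul_mem _ _ (Submodule.mem_iSup_of_mem i (Submodule.mem_iSup_of_mem
      (Finset.mem_range.mpr (by omega)) (Submodule.subset_span ?_)))
    have := S.T_mem hw (-(j / p))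
    rwa [add_assoc, ← Int.cast_add, show j + p * -(j / p) = i by rw [← hi]; linarith,
      Int.cast_natCast] at this
  · exact fun j _ => Submodule.span_mono fun w hw => Set.mem_iUnion.mpr ⟨(j : ℤ), by simpa using hw⟩

/-! ### Vanishing of the operators `t^{-pm} L_{r+pm} - L_r` -/

/-- The operator `t^{-pm} L_{r+pm} - L_r`. -/
def shiftDiff (i : ℤ × ℤ) : Module.End R V := S.T (-i.2) • S.X (i.1 + p * i.2) - S.X i.1

theorem commute_shiftDiff_X (i : ℤ × ℤ) (s : ℤ) : Commute (S.shiftDiff i) (S.X s) :=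
  ((S.X_X _ _).smul_left _).sub_left (S.X_X _ _)

theorem commute_shiftDiff (i j : ℤ × ℤ) : Commute (S.shiftDiff i) (S.shiftDiff j) :=
  ((S.commute_shiftDiff_X i _).smul_right _).sub_right (S.commute_shiftDiff_X i _)

theorem isNilpotent_shiftDiff (i : ℤ × ℤ) : IsNilpotent (S.shiftDiff i) := by
  obtain ⟨r, m⟩ := i
  have := S.module_finite
  have hp : (p : ℂ) ≠ 0 := by exact_mod_cast S.p_pos.ne'
  -- For `r = 0` the factor `r / p` in the commutator is not invertible, but there the operator is
  -- zero by the convention on `X`.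
  by_cases hr : r = 0
  · have : S.shiftDiff (r, m) = 0 := by
      have h0 := S.X_mul 0
      rw [mul_zero] at h0
      simp [shiftDiff, hr, S.X_mul, h0]
    rw [this]
    exact IsNilpotent.zero
  have h := isNilpotent_commutator (S.D_X m r) ((S.commute_shiftDiff_X (r, m) r).smul_left _)
  have hu : IsUnit (algebraMap ℂ R ((r : ℂ) / p)) :=
    (IsUnit.mk0 _ (div_ne_zero (by exact_mod_cast hr) hp)).map _
  obtain ⟨n, hn⟩ := h
  refine ⟨n, ?_⟩
  rw [smul_pow] at hn
  exact (hu.pow n).smul_eq_zero.mp hn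

theorem D_X_apply (m r : ℤ) (v : V) : S.D m (S.X r v) =
    S.X r (S.D m v) + algebraMap ℂ R ((r : ℂ) / p) • S.shiftDiff (r, m) v := by
  have := LinearMap.congr_fun (S.D_X m r) v
  rw [LinearMap.sub_apply, sub_eq_iff_eq_add'] at this
  exact this

theorem H_shiftDiff (i : ℤ × ℤ) (v : V) :
    S.H (S.shiftDiff i v) = S.shiftDiff i (S.H v) + (i.1 : ℂ) • S.shiftDiff i v := by
  simp only [shiftDiff, LinearMap.sub_apply, LinearMap.smul_apply, map_sub, S.H_T, S.H_X]
  push_cast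
  simp only [smul_add, smul_sub]
  rw [smul_comm (S.T (-i.2)) ((i.1 : ℂ) + p * i.2)]
  module

/-- The sum `J` of all the images is a submodule of the irreducible `V`. If it were `V`, finitely
many commuting nilpotents would already have images spanning `V`, forcing `V = 0`. -/
theorem shiftDiff_eq_zero (i : ℤ × ℤ) : S.shiftDiff i = 0 := by
  have hfin := S.module_finite
  have hnt := S.nontrivial
  set J : Submodule R V := ⨆ i, LinearMap.range (S.shiftDiff i)
  have hmem : ∀ i v, S.shiftDiff i v ∈ J := fun i v =>
    Submodule.mem_iSup_of_mem i ⟨v, rfl⟩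
  have hJ : J = Submodule.span R (⋃ i, (LinearMap.range (S.shiftDiff i) : Set V)) := by
    rw [Submodule.span_iUnion]; simp [J]
  have hcase : J = ⊥ ∨ J = ⊤ := by
    by_cases h0 : ∃ v ∈ (⋃ i, (LinearMap.range (S.shiftDiff i) : Set V)), v ≠ 0
    · right
      rw [hJ]
      apply S.span_eq_top _ h0
      all_goals
        rw [← hJ]
        simp only [Set.mem_iUnion, SetLike.mem_coe, LinearMap.mem_range]
      · rintro _ ⟨i, v, rfl⟩
        rw [H_shiftDiff, ← algebraMap_smul R]
        exact J.add_mem (hmem _ _) (J.smul_mem _ (hmem _ _))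
      · rintro n _ ⟨i, v, rfl⟩
        -- Both terms of a shift difference have commutators with `D n` that are `R`-multiples of
        -- shift differences, so `J` is stable under `D n`.
        have : S.D n (S.shiftDiff i v) = S.shiftDiff i (S.D n v) +
            (S.T (-i.2) • algebraMap ℂ R (((i.1 + p * i.2 : ℤ) : ℂ) / p) •
              S.shiftDiff (i.1 + p * i.2, n) v -
            algebraMap ℂ R ((i.1 : ℂ) / p) • S.shiftDiff (i.1, n) v) := by
          conv_lhs => rw [shiftDiff]
          conv_rhs => enter [1]; rw [shiftDiff]
          simp only [LinearMap.sub_apply, LinearMap.smul_apply, map_sub, map_smul, S.D_X_apply,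
            smul_add]
          abel
        rw [this]
        exact J.add_mem (hmem _ _) (J.sub_mem (J.smul_mem _ (J.smul_mem _ (hmem _ _)))
          (J.smul_mem _ (hmem _ _)))
      · rintro r _ ⟨i, v, rfl⟩
        have := LinearMap.congr_fun (S.commute_shiftDiff_X i r).eq v
        simp only [Module.End.mul_apply] at this
        rw [← this]
        exact hmem _ _
    · left
      push Not at h0
      rw [hJ, Submodule.span_eq_bot]
      exact h0
  rcases hcase with h | h
  · ext v
    have := hmem i v
    rw [h, Submodule.mem_bot] at this
    rw [this, LinearMap.zero_apply]
  · exfalso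
    -- Finite generation over `R` is compactness of `⊤`, which extracts finitely many images.
    obtain ⟨s, hs⟩ := CompleteLattice.IsCompactElement.exists_finset_of_le_iSup _
      ((Submodule.fg_iff_compact _).mp (hfin.fg_top)) (fun i => LinearMap.range (S.shiftDiff i))
      h.ge
    exact not_subsingleton V (subsingleton_of_iSup_range_eq_top S.shiftDiff
      S.isNilpotent_shiftDiff S.commute_shiftDiff s (top_le_iff.mp hs))

theorem commute_D_X (m r : ℤ) : Commute (S.D m) (S.X r) := by
  have := S.D_X m r
  change _ = _ • S.shiftDiff (r, m) at this
  rwa [S.shiftDiff_eq_zero, smul_zero, sub_eq_zero] at this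

/-! ### Linearity of `D m` in `m` -/

theorem H_secondDiff (j : ℤ) (v : V) :
    S.H (secondDiff S.D j v) = secondDiff S.D j (S.H v) := by
  simp only [secondDiff, LinearMap.add_apply, LinearMap.sub_apply, LinearMap.smul_apply, map_add,
    map_sub, map_zsmul, S.H_D]

theorem commute_secondDiff_X (j r : ℤ) : Commute (secondDiff S.D j) (S.X r) :=
  ((S.commute_D_X _ r).sub_left ((S.commute_D_X _ r).smul_left 2)).add_left (S.commute_D_X _ r)

/-- The `D m` have degree zero, so they act on a single weight space, where the finite-dimensional
statement applies. -/
theorem exists_secondDiff_apply_eq_zero : ∃ v, v ≠ 0 ∧ ∀ j, secondDiff S.D j v = 0 := by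
  obtain ⟨c, hc⟩ := S.exists_eigenspace_ne_bot
  have := S.finite_eigenspace c
  have : Nontrivial (S.H.eigenspace c) := Submodule.nontrivial_iff_ne_bot.mpr hc
  let D' : ℤ → Module.End ℂ (S.H.eigenspace c) := fun m =>
    ((S.D m).restrictScalars ℂ).restrict fun v hv => S.D_mem hv m
  have hD' : ∀ m u, (D' m u : V) = S.D m u := fun _ _ => rfl
  have hW : WittRel D' := fun m n => by
    ext u
    simpa [hD'] using LinearMap.congr_fun (S.D_D m n) u
  obtain ⟨v, hv, hz⟩ := hW.exists_secondDiff_eq_zero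
  refine ⟨v, fun h => hv (Subtype.ext h), fun j => ?_⟩
  have := congrArg Subtype.val (hz j)
  simpa [secondDiff, hD'] using this

/-- The common kernel is nonzero and is a submodule: second differences span an ideal under brackets
with the `D n`, and they commute with `H` and the `X r`. -/
theorem secondDiff_eq_zero (j : ℤ) : secondDiff S.D j = 0 := by
  let W : Submodule R V := ⨅ j, LinearMap.ker (secondDiff S.D j)
  have hW : ∀ v, v ∈ W ↔ ∀ j, secondDiff S.D j v = 0 := fun v => by
    simp [W, Submodule.mem_iInf]
  have htop : W = ⊤ := by
    refine (S.eq_bot_or_eq_top W ?_ ?_ ?_).resolve_left ?_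
    · intro v hv
      exact (hW _).mpr fun j => by rw [← S.H_secondDiff, (hW v).mp hv, map_zero]
    · intro m v hv
      refine mem_of_diff_mem S.D_zero W (fun n => (hW _).mpr fun j => ?_) m
      rw [S.D_D.secondDiff_apply, (hW v).mp hv, (hW v).mp hv, (hW v).mp hv]
      simp
    · intro r v hv
      refine (hW _).mpr fun j => ?_
      have := LinearMap.congr_fun (S.commute_secondDiff_X j r).eq v
      simp only [Module.End.mul_apply] at this
      rw [this, (hW v).mp hv, map_zero]
    · obtain ⟨v, hv, hz⟩ := S.exists_secondDiff_apply_eq_zero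
      intro h
      exact hv ((Submodule.mem_bot R).mp (h ▸ (hW v).mpr hz))
  ext v
  exact (hW v).mp (htop ▸ Submodule.mem_top) j

theorem D_eq_zsmul (m : ℤ) : S.D m = m • S.D 1 := by
  have hd : ∀ n, S.D (n + 1) - S.D n = S.D 1 := by
    have hs : ∀ n, S.D (n + 1) - S.D n = S.D n - S.D (n - 1) := fun n => by
      have := S.secondDiff_eq_zero n
      rw [secondDiff] at this
      rw [← sub_eq_zero, ← this]
      module
    intro n
    induction n using Int.induction_on with
    | zero => rw [zero_add, S.D_zero, sub_zero]
    | succ n ih => rw [hs, add_sub_cancel_right, ih]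
    | pred n ih => rw [sub_add_cancel, ← hs, ih]
  induction m using Int.induction_on with
  | zero => rw [S.D_zero, zero_smul]
  | succ n ih => rw [add_smul, ← ih, one_smul, ← hd n]; abel
  | pred n ih =>
    have := hd (-n - 1)
    rw [sub_add_cancel] at this
    rw [sub_smul, ← ih, one_smul, ← this]; abel

/-! ### Schur's lemma and one-dimensional weight spaces -/

/-- Schur's lemma. -/
theorem exists_eq_smul {P : Module.End R V} (hH : ∀ v, S.H (P v) = P (S.H v))
    (hD : Commute P (S.D 1)) (hX : ∀ r, Commute P (S.X r)) : ∃ a : ℂ, ∀ v, P v = a • v := by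
  obtain ⟨c, hc⟩ := S.exists_eigenspace_ne_bot
  have := S.finite_eigenspace c
  have : Nontrivial (S.H.eigenspace c) := Submodule.nontrivial_iff_ne_bot.mpr hc
  let P' : Module.End ℂ (S.H.eigenspace c) :=
    (P.restrictScalars ℂ).restrict fun v hv => by
      rw [Module.End.mem_eigenspace_iff] at hv ⊢
      rw [LinearMap.restrictScalars_apply, hH, hv, LinearMap.map_smul_of_tower]
  obtain ⟨a, ha⟩ := Module.End.exists_eigenvalue P'
  obtain ⟨u, hu⟩ := ha.exists_hasEigenvector
  refine ⟨a, fun v => ?_⟩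
  -- The eigenvalue `a` was found on one weight space, but its eigenspace in `V` is stable under all
  -- the operators, so it is everything.
  let W : Submodule R V := LinearMap.ker (P - algebraMap ℂ R a • 1)
  have hW : ∀ v, v ∈ W ↔ P v = a • v := fun v => by
    simp [W, sub_eq_zero]
  have hcomm : ∀ Q : Module.End R V, Commute P Q → ∀ w ∈ W, Q w ∈ W := fun Q hQ w hw => by
    have := LinearMap.congr_fun hQ.eq w
    simp only [Module.End.mul_apply] at this
    rw [hW] at hw ⊢
    rw [this, hw, LinearMap.map_smul_of_tower]
  have htop : W = ⊤ := by
    refine (S.eq_bot_or_eq_top W ?_ ?_ ?_).resolve_left ?_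
    · intro w hw
      rw [hW] at hw ⊢
      rw [← hH, hw, map_smul]
    · intro m
      rw [S.D_eq_zsmul]
      exact hcomm _ (hD.smul_right m)
    · exact fun r => hcomm _ (hX r)
    · intro h
      refine hu.2 (Subtype.ext ((Submodule.mem_bot R).mp (h ▸ (hW u).mpr ?_)))
      exact congrArg Subtype.val hu.apply_eq_smul
  exact (hW v).mp (htop ▸ Submodule.mem_top)

/-- The commutative monoid generated by the operators `t^n` and `L_r`. -/
def monomials : Submonoid (Module.End R V) :=
  Submonoid.closure (Set.range S.X ∪ Set.range fun k => S.T k • (1 : Module.End R V))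

theorem commute_monomial {P Q : Module.End R V} (hP : P ∈ S.monomials)
    (hQ : ∀ r, Commute Q (S.X r)) : Commute Q P := by
  induction hP using Submonoid.closure_induction with
  | mem x hx =>
    rcases hx with ⟨r, rfl⟩ | ⟨k, rfl⟩
    · exact hQ r
    · exact (Commute.one_right Q).smul_right _
  | one => exact Commute.one_right Q
  | mul x y _ _ hx hy => exact hx.mul_right hy

theorem exists_degree {P : Module.End R V} (hP : P ∈ S.monomials) :
    ∃ d : ℂ, ∀ v, S.H (P v) = P (S.H v) + d • P v := by
  induction hP using Submonoid.closure_induction with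
  | mem x hx =>
    rcases hx with ⟨r, rfl⟩ | ⟨k, rfl⟩
    · exact ⟨r, S.H_X r⟩
    · exact ⟨(p * k : ℤ), fun v => by simpa using S.H_T k v⟩
  | one => exact ⟨0, by simp⟩
  | mul x y _ _ hx hy =>
    obtain ⟨d, hd⟩ := hx
    obtain ⟨e, he⟩ := hy
    refine ⟨d + e, fun v => ?_⟩
    simp only [Module.End.mul_apply]
    rw [hd, he, map_add, LinearMap.map_smul_of_tower]
    module

/-- No `D m` is needed to generate, since `D m = m • D 1` acts by a scalar; and `H` scales each `P
w`, as `P` is homogeneous and `w` is a weight vector. -/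
theorem span_monomials_apply {w : V} (hw : w ≠ 0) {c : ℂ} (hc : S.H w = c • w) :
    Submodule.span ℂ {u | ∃ P ∈ S.monomials, u = P w} = ⊤ := by
  set W := Submodule.span ℂ {u | ∃ P ∈ S.monomials, u = P w}
  have hstab : ∀ Q : Module.End R V, (∀ P ∈ S.monomials, Q (P w) ∈ W) → ∀ u ∈ W, Q u ∈ W := by
    intro Q hQ u hu
    refine (Submodule.span_le (p := W.comap (Q.restrictScalars ℂ))).mpr ?_ hu
    rintro _ ⟨P, hP, rfl⟩
    exact hQ P hP
  have hmul : ∀ Q ∈ S.monomials, ∀ u ∈ W, Q u ∈ W := fun Q hQ => hstab Q fun P hP =>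
    Submodule.subset_span ⟨Q * P, mul_mem hQ hP, rfl⟩
  obtain ⟨a, ha⟩ := S.exists_eq_smul (fun v => S.H_D 1 v) (Commute.refl _) (S.commute_D_X 1)
  refine (S.irr W ?_ ?_ ?_ ?_).resolve_left ?_
  · intro k u hu
    exact hmul _ (Submonoid.subset_closure (Or.inr ⟨k, rfl⟩)) u hu
  · intro u hu
    refine (Submodule.span_le (p := W.comap S.H)).mpr ?_ hu
    rintro _ ⟨P, hP, rfl⟩
    obtain ⟨d, hd⟩ := S.exists_degree hP
    have hPW : P w ∈ W := Submodule.subset_span ⟨P, hP, rfl⟩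
    rw [SetLike.mem_coe, Submodule.mem_comap, hd, hc, LinearMap.map_smul_of_tower]
    exact W.add_mem (W.smul_mem _ hPW) (W.smul_mem _ hPW)
  · intro m u hu
    rw [S.D_eq_zsmul, LinearMap.smul_apply, ha]
    exact W.smul_of_tower_mem m (W.smul_mem a hu)
  · exact fun r u hu => hmul _ (Submonoid.subset_closure (Or.inl ⟨r, rfl⟩)) u hu
  · intro h
    have : w ∈ W := Submodule.subset_span ⟨1, one_mem _, rfl⟩
    rw [h, Submodule.mem_bot] at this
    exact hw this

theorem exists_smul_eq_of_mem_eigenspace {c : ℂ} {w v : V} (hw0 : w ≠ 0)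
    (hw : w ∈ S.H.eigenspace c) (hv : v ∈ S.H.eigenspace c) : ∃ a : ℂ, a • w = v := by
  have hw' := Module.End.mem_eigenspace_iff.mp hw
  -- A monomial of degree zero sends `w` to a multiple of itself by Schur's lemma, and any other
  -- moves it to a different eigenspace. Independence of eigenspaces then isolates weight `c`.
  have htop : (⊤ : Submodule ℂ V) ≤ Submodule.span ℂ {w} ⊔ ⨆ d ≠ c, S.H.eigenspace d := by
    rw [← S.span_monomials_apply hw0 hw', Submodule.span_le]
    rintro _ ⟨P, hP, rfl⟩
    obtain ⟨d, hd⟩ := S.exists_degree hP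
    by_cases h0 : d = 0
    · obtain ⟨a, ha⟩ := S.exists_eq_smul (P := P) (fun v => by rw [hd, h0, zero_smul, add_zero])
        (S.commute_monomial hP (S.commute_D_X 1)).symm
        (fun r => (S.commute_monomial hP (S.X_X r)).symm)
      rw [ha]
      exact Submodule.mem_sup_left (Submodule.smul_mem _ _ (Submodule.mem_span_singleton_self w))
    · refine Submodule.mem_sup_right (Submodule.mem_iSup_of_mem (c + d)
        (Submodule.mem_iSup_of_mem (by simpa using h0) ?_))
      rw [Module.End.mem_eigenspace_iff, hd, hw', LinearMap.map_smul_of_tower, add_smul]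
  obtain ⟨x, hx, y, hy, hxy⟩ := Submodule.mem_sup.mp (htop (Submodule.mem_top : v ∈ _))
  obtain ⟨a, rfl⟩ := Submodule.mem_span_singleton.mp hx
  refine ⟨a, ?_⟩
  have hyc : y ∈ S.H.eigenspace c := by
    rw [← hxy] at hv
    exact (Submodule.add_mem_iff_right _ (Submodule.smul_mem _ a hw)).mp hv
  have := Submodule.disjoint_def.mp (S.H.eigenspaces_iSupIndep c) y hyc hy
  rw [← hxy, this, add_zero]

end IrredOperators

/-! ### Spanning sets of `A` and `g'`, and the bracket relations on a module -/

section Algebra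

variable {p : ℕ}

/-- The element `t^{pk}` of `A`. -/
def tPow (p : ℕ) (k : ℤ) : A p := t p ⟨(p : ℤ) * k, k, by simp [mul_comm]⟩

theorem tPow_zero : tPow p 0 = 1 := by
  simp only [tPow, mul_zero]
  rfl

theorem tPow_add (k l : ℤ) : tPow p (k + l) = tPow p k * tPow p l := by
  simp only [tPow, t, AddMonoidAlgebra.single_mul_single, mul_one]
  congr 1
  exact Subtype.ext (mul_add _ _ _)

theorem span_tPow : Submodule.span ℂ (Set.range (tPow p)) = ⊤ := by
  refine top_le_iff.mp fun a _ => ?_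
  induction a using AddMonoidAlgebra.induction_linear with
  | zero => exact Submodule.zero_mem _
  | add f g hf hg => exact Submodule.add_mem _ (hf trivial) (hg trivial)
  | single n c =>
    obtain ⟨n, k, hk⟩ := n
    have hk' : (p : ℤ) * k = n := by rw [← hk, mul_comm]; rfl
    subst hk'
    have : (AddMonoidAlgebra.single (⟨(p : ℤ) * k, ⟨k, hk⟩⟩ : AddSubgroup.zmultiples (p : ℤ)) c :
        A p) = c • tPow p k := by
      rw [tPow, t, AddMonoidAlgebra.smul_single, smul_eq_mul, mul_one]
    have h := Submodule.smul_mem _ c (Submodule.subset_span (R := ℂ) (Set.mem_range_self k) :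
      tPow p k ∈ _)
    rwa [← this] at h

theorem span_L : Submodule.span ℂ (Set.range (L p)) = ⊤ := by
  have h : (Submodule.span ℂ (Set.range (L p))).mkQ = 0 := GPrime.hom_ext fun a => by
    rw [LinearMap.zero_apply, Submodule.mkQ_apply, Submodule.Quotient.mk_eq_zero]
    exact Submodule.subset_span ⟨a, rfl⟩
  rw [← Submodule.ker_mkQ (Submodule.span ℂ (Set.range (L p))), h, LinearMap.ker_zero]

end Algebra

section AModule

variable {p : ℕ} {V : Type*} [AddCommGroup V] [Module ℂ V] [Module (A p) V]
  [IsScalarTower ℂ (A p) V]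

theorem smul_mem_of_tPow_smul_mem (W : Submodule ℂ V) (hW : ∀ k, ∀ w ∈ W, tPow p k • w ∈ W)
    (a : A p) {w : V} (hw : w ∈ W) : a • w ∈ W := by
  have ha : a ∈ Submodule.span ℂ (Set.range (tPow p)) := by rw [span_tPow]; trivial
  induction ha using Submodule.span_induction with
  | mem x hx => obtain ⟨k, rfl⟩ := hx; exact hW k w hw
  | zero => simp
  | add x y _ _ hx hy => rw [add_smul]; exact W.add_mem hx hy
  | smul c x _ hx => rw [smul_assoc]; exact W.smul_mem c hx

/-- A `ℂ`-linear map commuting with the `t^{pk}` is `A`-linear. -/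
def linearMapOfTPow (f : Module.End ℂ V) (hf : ∀ k v, f (tPow p k • v) = tPow p k • f v) :
    Module.End (A p) V where
  toFun := f
  map_add' := map_add f
  map_smul' a v := by
    have ha : a ∈ Submodule.span ℂ (Set.range (tPow p)) := by rw [span_tPow]; trivial
    change f (a • v) = a • f v
    induction ha using Submodule.span_induction with
    | mem x hx => obtain ⟨k, rfl⟩ := hx; exact hf k v
    | zero => simp
    | add x y _ _ hx hy => rw [add_smul, map_add, hx, hy, add_smul]
    | smul c x _ hx => rw [smul_assoc, map_smul, hx, smul_assoc]

end AModule

section LieModule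


variable {p : ℕ} {V : Type*} [AddCommGroup V] [Module ℂ V]
    [LieRingModule (GPrime p) V] [LieModule ℂ (GPrime p) V]

theorem lie_L_L (a b : ℤ) : ⁅L p a, L p b⁆ = (structConst p a b : ℂ) • L p (a + b) :=
  bracketPrime_L p a b

theorem lie_L_lie_L (a b : ℤ) (v : V) :
    ⁅L p a, ⁅L p b, v⁆⁆ = ⁅L p b, ⁅L p a, v⁆⁆ + (structConst p a b : ℂ) • ⁅L p (a + b), v⁆ := by
  rw [leibniz_lie, lie_L_L, smul_lie, add_comm]

theorem lie_mem_of_L_lie_mem (W : Submodule ℂ V) (hW : ∀ a, ∀ w ∈ W, ⁅L p a, w⁆ ∈ W)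
    (x : GPrime p) {w : V} (hw : w ∈ W) : ⁅x, w⁆ ∈ W := by
  have hx : x ∈ Submodule.span ℂ (Set.range (L p)) := by rw [span_L]; trivial
  induction hx using Submodule.span_induction with
  | mem x hx => obtain ⟨k, rfl⟩ := hx; exact hW k w hw
  | zero => simp
  | add x y _ _ hx hy => rw [add_lie]; exact W.add_mem hx hy
  | smul c x _ hx => rw [smul_lie]; exact W.smul_mem c hx

theorem lie_zero_lie (a : ℤ) (v : V) :
    ⁅L p 0, ⁅L p a, v⁆⁆ = ⁅L p a, ⁅L p 0, v⁆⁆ + (a : ℂ) • ⁅L p a, v⁆ := by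
  rw [lie_L_lie_L, zero_add]
  simp [structConst]

end LieModule

/-! ### The `A`-linear operators of an `Ag'`-module -/

namespace IsAGPrimeModule

section

variable {p : ℕ} {V : Type*} [AddCommGroup V] [Module ℂ V] [LieRingModule (GPrime p) V]
  [Module (A p) V]

theorem lie_tPow_smul (hV : IsAGPrimeModule p V) (m n : ℤ) (v : V) :
    ⁅L p (p * m), tPow p n • v⁆ =
      tPow p n • ⁅L p (p * m), v⁆ + ((p * n : ℤ) : ℂ) • tPow p (m + n) • v := by
  have := hV.lie_t_smul ⟨(p : ℤ) * m, m, by simp [mul_comm]⟩ ⟨(p : ℤ) * n, n, by simp [mul_comm]⟩ v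
  rw [sub_eq_iff_eq_add'] at this
  rw [tPow, tPow, this]
  congr 4
  exact Subtype.ext (mul_add _ _ _).symm

theorem lie_zero_tPow_smul (hV : IsAGPrimeModule p V) (n : ℤ) (v : V) :
    ⁅L p 0, tPow p n • v⁆ = tPow p n • ⁅L p 0, v⁆ + ((p * n : ℤ) : ℂ) • tPow p n • v := by
  simpa using hV.lie_tPow_smul 0 n v

theorem lie_tPow_smul_of_not_dvd (hV : IsAGPrimeModule p V) {r : ℤ} (hr : ¬ (p : ℤ) ∣ r) (n : ℤ)
    (v : V) : ⁅L p r, tPow p n • v⁆ = tPow p n • ⁅L p r, v⁆ :=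
  (hV.t_smul_lie _ r hr v).symm

end

variable {p : ℕ} {V : Type*} [AddCommGroup V] [Module ℂ V]
  [LieRingModule (GPrime p) V] [LieModule ℂ (GPrime p) V]
  [Module (A p) V] [IsScalarTower ℂ (A p) V]

/-- The action of `L_a` as a `ℂ`-linear map. -/
def opL (p : ℕ) (V : Type*) [AddCommGroup V] [Module ℂ V]
    [LieRingModule (GPrime p) V] [LieModule ℂ (GPrime p) V] (a : ℤ) : Module.End ℂ V :=
  LieModule.toEnd ℂ (GPrime p) V (L p a)

/-- The `A`-linear operator `(t^{-pm} L_{pm} - L_0) / p`. -/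
def opD (hV : IsAGPrimeModule p V) (m : ℤ) : Module.End (A p) V :=
  linearMapOfTPow ((p : ℂ)⁻¹ • (Algebra.lsmul ℂ ℂ V (tPow p (-m)) * opL p V (p * m) - opL p V 0))
    fun k v => by
      change (p : ℂ)⁻¹ • (tPow p (-m) • ⁅L p (p * m), tPow p k • v⁆ - ⁅L p 0, tPow p k • v⁆) =
        tPow p k • ((p : ℂ)⁻¹ • (tPow p (-m) • ⁅L p (p * m), v⁆ - ⁅L p 0, v⁆))
      rw [hV.lie_tPow_smul, hV.lie_zero_tPow_smul, smul_comm (tPow p k), smul_add,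
        smul_comm (tPow p (-m)) ((p * k : ℤ) : ℂ), smul_smul (tPow p (-m)) (tPow p (m + k)),
        ← tPow_add, neg_add_cancel_left, add_sub_add_right_eq_sub, smul_sub (tPow p k),
        smul_comm (tPow p k)]

theorem opD_apply (hV : IsAGPrimeModule p V) (m : ℤ) (v : V) :
    hV.opD m v = (p : ℂ)⁻¹ • (tPow p (-m) • ⁅L p (p * m), v⁆ - ⁅L p 0, v⁆) := rfl

open Classical in
/-- The `A`-linear operator `L_r` if `r ∉ pℤ`, and zero otherwise. -/
def opX (hV : IsAGPrimeModule p V) (r : ℤ) : Module.End (A p) V :=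
  if hr : (p : ℤ) ∣ r then 0 else
    linearMapOfTPow (opL p V r) fun k v => hV.lie_tPow_smul_of_not_dvd hr k v

theorem opX_of_dvd (hV : IsAGPrimeModule p V) {r : ℤ} (hr : (p : ℤ) ∣ r) : hV.opX r = 0 :=
  dif_pos hr

theorem opX_apply (hV : IsAGPrimeModule p V) {r : ℤ} (hr : ¬ (p : ℤ) ∣ r) (v : V) :
    hV.opX r v = ⁅L p r, v⁆ := by
  rw [opX, dif_neg hr]
  rfl

theorem lie_mul_eq (hV : IsAGPrimeModule p V) (hp : (p : ℂ) ≠ 0) (m : ℤ) (v : V) :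
    ⁅L p (p * m), v⁆ = tPow p m • ((p : ℂ) • hV.opD m v + ⁅L p 0, v⁆) := by
  rw [opD_apply, smul_smul, mul_inv_cancel₀ hp, one_smul, sub_add_cancel, smul_smul, ← tPow_add,
    add_neg_cancel, tPow_zero, one_smul]

theorem lie_opD (hV : IsAGPrimeModule p V) (m : ℤ) (v : V) :
    ⁅L p 0, hV.opD m v⁆ = hV.opD m ⁅L p 0, v⁆ := by
  rw [opD_apply, opD_apply, lie_smul, lie_sub, hV.lie_zero_tPow_smul, lie_zero_lie]
  push_cast
  rw [smul_add, smul_comm (tPow p (-m))]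
  module

/-- Normal ordering, with powers of `t` on the left. The terms involving `L_0` are symmetric in `m`
and `n` jointly, so they cancel in the commutator. -/
theorem opD_opD (hV : IsAGPrimeModule p V) (m n : ℤ) (v : V) :
    hV.opD m (hV.opD n v) = ((p : ℂ)⁻¹ * (p : ℂ)⁻¹) • (
      tPow p (-(m + n)) • ⁅L p (p * m), ⁅L p (p * n), v⁆⁆
      - ((p * n : ℤ) : ℂ) • tPow p (-n) • ⁅L p (p * n), v⁆
      - tPow p (-m) • ⁅L p (p * m), ⁅L p 0, v⁆⁆ - tPow p (-n) • ⁅L p (p * n), ⁅L p 0, v⁆⁆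
      + ⁅L p 0, ⁅L p 0, v⁆⁆) := by
  rw [opD_apply, lie_opD, opD_apply, opD_apply, lie_smul, lie_sub, hV.lie_tPow_smul,
    smul_comm (tPow p (-m)) (p : ℂ)⁻¹, ← smul_sub, smul_smul]
  congr 1
  rw [smul_sub, smul_add, smul_comm (tPow p (-m)) ((p * (-n) : ℤ) : ℂ), smul_smul (tPow p (-m)),
    smul_smul (tPow p (-m)) (tPow p (m + -n)), ← tPow_add, ← tPow_add, neg_add_cancel_left,
    show -m + -n = -(m + n) by ring]
  push_cast
  module

theorem wittRel_opD (hV : IsAGPrimeModule p V) (hp : (p : ℂ) ≠ 0) : WittRel hV.opD := by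
  intro m n
  ext v
  simp only [LinearMap.sub_apply, LinearMap.add_apply, LinearMap.smul_apply, Module.End.mul_apply]
  rw [opD_opD, opD_opD, add_comm n m, lie_L_lie_L (p * m) (p * n), ← smul_sub, smul_add,
    smul_comm (tPow p (-(m + n))) ((structConst p (p * m) (p * n) : ℤ) : ℂ)]
  have hs : structConst p (p * m) (p * n) = p * n - p * m := by simp [structConst]
  rw [hs, ← mul_add, opD_apply, opD_apply, opD_apply]
  simp only [← Int.cast_smul_eq_zsmul ℂ]
  generalize tPow p (-(m + n)) • ⁅L p (p * (m + n)), v⁆ = a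
  generalize tPow p (-m) • ⁅L p (p * m), v⁆ = b
  generalize tPow p (-n) • ⁅L p (p * n), v⁆ = c
  generalize tPow p (-(m + n)) • ⁅L p (p * n), ⁅L p (p * m), v⁆⁆ = d
  generalize tPow p (-m) • ⁅L p (p * m), ⁅L p 0, v⁆⁆ = e
  generalize tPow p (-n) • ⁅L p (p * n), ⁅L p 0, v⁆⁆ = f
  push_cast
  match_scalars <;> field_simp <;> ring

theorem opD_opX (hV : IsAGPrimeModule p V) (hp : (p : ℂ) ≠ 0) (m r : ℤ) :
    hV.opD m * hV.opX r - hV.opX r * hV.opD m =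
      algebraMap ℂ (A p) ((r : ℂ) / p) • (tPow p (-m) • hV.opX (r + p * m) - hV.opX r) := by
  by_cases hr : (p : ℤ) ∣ r
  · rw [opX_of_dvd hV hr, opX_of_dvd hV (dvd_add hr (dvd_mul_right _ _))]
    simp
  have hr' : ¬ (p : ℤ) ∣ r + p * m := by rwa [dvd_add_left (dvd_mul_right _ _)]
  ext v
  simp only [LinearMap.sub_apply, LinearMap.smul_apply, Module.End.mul_apply, algebraMap_smul,
    opX_apply hV hr, opX_apply hV hr', opD_apply, lie_smul, lie_sub, lie_zero_lie,
    hV.lie_tPow_smul_of_not_dvd hr]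
  rw [lie_L_lie_L (p * m) r, smul_add,
    smul_comm (tPow p (-m)) ((structConst p (p * m) r : ℤ) : ℂ), add_comm _ r]
  have hs : structConst p (p * m) r = r := by simp [structConst, hr]
  rw [hs]
  generalize tPow p (-m) • ⁅L p (r + p * m), v⁆ = a
  generalize tPow p (-m) • ⁅L p r, ⁅L p (p * m), v⁆⁆ = b
  match_scalars <;> field_simp <;> ring

theorem commute_opX (hV : IsAGPrimeModule p V) (r s : ℤ) : Commute (hV.opX r) (hV.opX s) := by
  by_cases hr : (p : ℤ) ∣ r
  · rw [opX_of_dvd hV hr]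
    exact Commute.zero_left _
  by_cases hs : (p : ℤ) ∣ s
  · rw [opX_of_dvd hV hs]
    exact Commute.zero_right _
  ext v
  simp only [Module.End.mul_apply, opX_apply hV hr, opX_apply hV hs]
  rw [lie_L_lie_L]
  simp [structConst, hr, hs]

theorem lie_opX (hV : IsAGPrimeModule p V) (r : ℤ) (v : V) :
    ⁅L p 0, hV.opX r v⁆ = hV.opX r ⁅L p 0, v⁆ + (r : ℂ) • hV.opX r v := by
  by_cases hr : (p : ℤ) ∣ r
  · simp [opX_of_dvd hV hr]
  · rw [opX_apply hV hr, opX_apply hV hr, lie_zero_lie]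

/-- The operators of an irreducible `Ag'`-module with finite-dimensional weight spaces. -/
def irredOperators (hV : IsAGPrimeModule p V) (hp : 0 < p) (hirr : IsIrreducibleAG p V)
    (htop : ⨆ c, (opL p V 0).eigenspace c = ⊤)
    (hfin : ∀ c, FiniteDimensional ℂ ((opL p V 0).eigenspace c)) :
    IrredOperators p (A p) V where
  T := tPow p
  H := opL p V 0
  D := hV.opD
  X := hV.opX
  p_pos := hp
  T_zero := tPow_zero
  T_add := tPow_add
  span_T := span_tPow
  H_T := hV.lie_zero_tPow_smul
  H_D := hV.lie_opD
  H_X := hV.lie_opX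
  D_zero := by
    ext v
    simp [opD_apply, tPow_zero]
  D_D := hV.wittRel_opD (by exact_mod_cast hp.ne')
  D_X := hV.opD_opX (by exact_mod_cast hp.ne')
  X_X := hV.commute_opX
  X_mul m := hV.opX_of_dvd (dvd_mul_right _ _)
  nontrivial := hirr.1
  irr W hT hH hD hX := by
    refine hirr.2 W (fun a w hw => smul_mem_of_tPow_smul_mem W hT a hw)
      fun x w hw => lie_mem_of_L_lie_mem W (fun a w hw => ?_) x hw
    by_cases ha : (p : ℤ) ∣ a
    · obtain ⟨m, rfl⟩ := ha
      rw [hV.lie_mul_eq (by exact_mod_cast hp.ne')]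
      exact hT _ _ (W.add_mem (W.smul_mem _ (hD m w hw)) (hH w hw))
    · rw [← hV.opX_apply ha]
      exact hX a w hw
  iSup_eigenspace := htop
  finite_eigenspace := hfin

end IsAGPrimeModule

/-! ### Weights of `g_0` and eigenvalues of `L_0` -/

section Weights

variable (p : ℕ) (V : Type*) [AddCommGroup V] [Module ℂ V]
  [LieRingModule (GPrime p) V] [LieModule ℂ (GPrime p) V]

theorem weightSpace_le_eigenspace (lam : Module.Dual ℂ (Gap.cartan p)) :
    weightSpace p V lam ≤ (IsAGPrimeModule.opL p V 0).eigenspace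
      (lam ⟨Gap.L p 0, Submodule.subset_span (Set.mem_insert _ _)⟩) := fun _ hv =>
  Module.End.mem_eigenspace_iff.mpr (hv ⟨Gap.L p 0, _⟩)

/-- The weight of `g_0` with value `c` on `L_0` and zero on the centre. -/
def weightOf (c : ℂ) : Module.Dual ℂ (Gap.cartan p) :=
  -- The value `c` at `L_a` with `a ≠ 0` is immaterial: `g_0` projects onto the line of `L_0`.
  ((GPrime.lift p fun _ => c) ∘ₗ (Gap.proj p : Gap p →ₗ[ℂ] GPrime p)) ∘ₗ (Gap.cartan p).subtype

theorem eigenspace_le_weightSpace (c : ℂ) :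
    (IsAGPrimeModule.opL p V 0).eigenspace c ≤ weightSpace p V (weightOf p c) := by
  rintro v hv ⟨a, ha⟩
  have hv' : ⁅L p 0, v⁆ = c • v := Module.End.mem_eigenspace_iff.mp hv
  change ⁅Gap.proj p a, v⁆ = GPrime.lift p (fun _ => c) (Gap.proj p a) • v
  induction ha using Submodule.span_induction with
  | mem x hx =>
    rcases hx with rfl | ⟨i, rfl⟩
    · change ⁅L p 0, v⁆ = GPrime.lift p (fun _ => c) (L p 0) • v
      rw [GPrime.lift_L, hv']
    · change ⁅(0 : GPrime p), v⁆ = GPrime.lift p (fun _ => c) (0 : GPrime p) • v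
      rw [zero_lie, map_zero, zero_smul]
  | zero => simp
  | add x y _ _ hx hy => rw [map_add, add_lie, hx, hy, map_add, add_smul]
  | smul b x _ hx => rw [map_smul, smul_lie, hx, map_smul, smul_assoc]

end Weights

end GapVir

end

theorem theorem3p7 (p : ℕ) (hp : 1 < p) (V : Type*) [AddCommGroup V] [Module ℂ V]
    [LieRingModule (GapVir.GPrime p) V] [LieModule ℂ (GapVir.GPrime p) V]
    [Module (GapVir.A p) V] [IsScalarTower ℂ (GapVir.A p) V]
    (hV : GapVir.IsAGPrimeModule p V)
    (hirr : GapVir.IsIrreducibleAG p V)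
    (hcusp : GapVir.IsCuspidal p V) :
    GapVir.IsMOIS p V := by
  obtain ⟨hw, k, -, hk⟩ := hcusp
  have htop : ⨆ c, (GapVir.IsAGPrimeModule.opL p V 0).eigenspace c = ⊤ :=
    top_le_iff.mp (hw.ge.trans (iSup_le fun lam =>
      (GapVir.weightSpace_le_eigenspace p V lam).trans (le_iSup _ _)))
  -- The centre acts by zero, so each `L_0`-eigenspace lies in one weight space and inherits its
  -- bound.
  have hfin : ∀ c, FiniteDimensional ℂ ((GapVir.IsAGPrimeModule.opL p V 0).eigenspace c) :=
    fun c => Module.rank_lt_aleph0_iff.mp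
      ((Submodule.rank_mono (GapVir.eigenspace_le_weightSpace p V c)).trans_lt
        ((hk _).trans (Cardinal.natCast_lt_aleph0)))
  let S := hV.irredOperators (by omega) hirr htop hfin
  refine ⟨hw, fun lam => (rank_submodule_le_one_iff _).mpr ?_⟩
  by_cases h0 : GapVir.weightSpace p V lam = ⊥
  · exact ⟨0, Submodule.zero_mem _, by simp [h0]⟩
  obtain ⟨w, hwl, hw0⟩ := Submodule.exists_mem_ne_zero_of_ne_bot h0
  refine ⟨w, hwl, fun v hv => Submodule.mem_span_singleton.mpr ?_⟩
  exact S.exists_smul_eq_of_mem_eigenspace hw0 (GapVir.weightSpace_le_eigenspace p V lam hwl)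
    (GapVir.weightSpace_le_eigenspace p V lam hv)
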